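/- For $a\in\mathbb{C}$ and an integer $k\ge 0$ put $(a)_k = a(a+1)\cdots(a+k-1)$, with $(a)_0=1$. Infinite sums are limits of partial sums (convergence may be conditional). (i) (Ramanujan's series for $1/\pi$.) The following series converges, and $$\frac{2}{\pi} = \sum_{k=0}^{\infty} (-1)^k (4k+1)\, \frac{(1/2)_k^3}{k!^3}.$$ (ii) More generally, for every $n\in\mathbb{C}$ with $\operatorname{Re} n > -3/4$ the following series converges, and $$\frac{\Gamma(3/2+n)}{\Gamma(3/2)\,\Gamma(n+1)} = \sum_{k=0}^{\infty} (-1)^k (4k+1)\, \frac{(1/2)_k^2\,(-n)_k}{k!^2\,(3/2+n)_k}.$$ For nonnegative integers $n$ this series terminates, and for $n=-1/2$ it is the series in (i). -/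

import Mathlib

open Filter Topology Polynomial

/-! The series is the case a = 1/2, b = 1/2, c = -n of an alternating very-well-poised sum S(a),
normalised to have first term 1. Partial sums of S(a) and of a multiple of S(a+1) differ by a single
boundary term (`sum_veryWellPoised_sub`), which vanishes in the limit
(`tendsto_natCast_mul_wellPoised`). With a = m + 1/2 the multiple is a ratio of consecutive values
R(m) of `gammaQuotient`, so S(m + 1/2) / R(m) does not depend on m. As m → ∞, S → 1 by dominated
convergence and R → 1 by Euler's limit for Γ, hence S(1/2) = R(0). For large m the series converges
absolutely, and the contiguity carries convergence down to m = 0, where it may be only conditional.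
-/

/-- The rising factorial `(a)_k = a (a + 1) ⋯ (a + k - 1)`. -/
noncomputable def rising (a : ℂ) (k : ℕ) : ℂ := (ascPochhammer ℂ k).eval a

@[simp] lemma rising_zero (a : ℂ) : rising a 0 = 1 := by simp [rising]

lemma rising_succ (a : ℂ) (k : ℕ) : rising a (k + 1) = rising a k * (a + k) :=
  ascPochhammer_succ_eval k a

lemma rising_one (k : ℕ) : rising 1 k = (k.factorial : ℂ) := ascPochhammer_eval_one ℂ k

lemma rising_ne_zero {a : ℂ} (ha : ∀ k : ℕ, a + k ≠ 0) (k : ℕ) : rising a k ≠ 0 := by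
  induction k with
  | zero => simp
  | succ k ih => rw [rising_succ]; exact mul_ne_zero ih (ha k)

lemma mul_rising_add_one (a : ℂ) (k : ℕ) : a * rising (a + 1) k = rising a k * (a + k) := by
  induction k with
  | zero => simp
  | succ k ih =>
    rw [rising_succ, rising_succ, ← mul_assoc, ih]
    push_cast
    ring

/-! ### Well-poised terms and contiguity in a -/

/-- The alternating well-poised hypergeometric term, without the linear factor `a + 2 k`. -/
noncomputable def wellPoised (a b c : ℂ) (k : ℕ) : ℂ :=
  (-1) ^ k * (rising a k * rising b k * rising c k) /
    (a * (rising 1 k * rising (1 + a - b) k * rising (1 + a - c) k))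

/-- The very-well-poised term. -/
noncomputable def veryWellPoised (a b c : ℂ) (k : ℕ) : ℂ := (a + 2 * k) * wellPoised a b c k

lemma wellPoised_succ {a b c : ℂ} (ha : a ≠ 0) (hb : ∀ k : ℕ, 1 + a - b + k ≠ 0)
    (hc : ∀ k : ℕ, 1 + a - c + k ≠ 0) (k : ℕ) :
    (k + 1) * wellPoised a b c (k + 1) = -(wellPoised a b c k * ((a + k) * (b + k) * (c + k)) /
      ((1 + a - b + k) * (1 + a - c + k))) := by
  have h1 : (1 + k : ℂ) ≠ 0 := by norm_cast; omega
  have h1k : rising 1 k ≠ 0 := rising_one k ▸ Nat.cast_ne_zero.2 k.factorial_ne_zero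
  have hbk := rising_ne_zero hb k
  have hck := rising_ne_zero hc k
  have hb' := hb k
  have hc' := hc k
  simp only [wellPoised, rising_succ, pow_succ]
  field_simp
  ring

/-- Since a (a+1)_k = (a)_k (a+k), the shifted term is a rational multiple of the unshifted one,
which reduces contiguity to a rational identity. -/
lemma wellPoised_add_one {a b c : ℂ} (ha : a ≠ 0) (ha1 : a + 1 ≠ 0)
    (hb : ∀ k : ℕ, 1 + a - b + k ≠ 0) (hc : ∀ k : ℕ, 1 + a - c + k ≠ 0) (k : ℕ) :
    (1 + a) * wellPoised (a + 1) b c k / ((1 + a - b) * (1 + a - c)) =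
      wellPoised a b c k * (a + k) / ((1 + a - b + k) * (1 + a - c + k)) := by
  have h1k : rising 1 k ≠ 0 := rising_one k ▸ Nat.cast_ne_zero.2 k.factorial_ne_zero
  have hbk := rising_ne_zero hb k
  have hck := rising_ne_zero hc k
  have hb' := hb k
  have hc' := hc k
  have hb0 : 1 + a - b ≠ 0 := by simpa using hb 0
  have hc0 : 1 + a - c ≠ 0 := by simpa using hc 0
  have ea := mul_rising_add_one a k
  have eb := mul_rising_add_one (1 + a - b) k
  have ec := mul_rising_add_one (1 + a - c) k
  have ea' : rising (a + 1) k = rising a k * (a + k) / a := by rw [← ea]; field_simp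
  have eb' : rising (1 + (a + 1) - b) k = rising (1 + a - b) k * (1 + a - b + k) / (1 + a - b) := by
    rw [← eb, show 1 + (a + 1) - b = 1 + a - b + 1 by ring]; field_simp
  have ec' : rising (1 + (a + 1) - c) k = rising (1 + a - c) k * (1 + a - c + k) / (1 + a - c) := by
    rw [← ec, show 1 + (a + 1) - c = 1 + a - c + 1 by ring]; field_simp
  simp only [wellPoised, ea', eb', ec']
  generalize 1 + a - b + k = x at *
  generalize 1 + a - c + k = y at *
  generalize 1 + a - b = z at *
  generalize 1 + a - c = w at *
  field_simp
  ring

/-- Contiguity of the truncated very-well-poised sums under `a ↦ a + 1`. -/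
lemma sum_veryWellPoised_sub {a b c : ℂ} (ha : a ≠ 0) (ha1 : a + 1 ≠ 0)
    (hb : ∀ k : ℕ, 1 + a - b + k ≠ 0) (hc : ∀ k : ℕ, 1 + a - c + k ≠ 0) (N : ℕ) :
    ∑ k ∈ Finset.range N, veryWellPoised a b c k -
      (1 + a) * (1 + a - b - c) / ((1 + a - b) * (1 + a - c)) *
        ∑ k ∈ Finset.range N, veryWellPoised (a + 1) b c k = -(N * wellPoised a b c N) := by
  induction N with
  | zero => simp
  | succ N ih =>
    have h1 := wellPoised_succ ha hb hc N
    have h2 := wellPoised_add_one ha ha1 hb hc N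
    have hb' := hb N
    have hc' := hc N
    have key : (1 + a) * (1 + a - b - c) / ((1 + a - b) * (1 + a - c)) *
        veryWellPoised (a + 1) b c N = (1 + a - b - c) * (a + 1 + 2 * N) *
          (wellPoised a b c N * (a + N) / ((1 + a - b + N) * (1 + a - c + N))) := by
      rw [← h2, veryWellPoised]; ring
    rw [Finset.sum_range_succ, Finset.sum_range_succ, mul_add, key, Nat.cast_succ, h1]
    rw [sub_eq_iff_eq_add] at ih
    rw [ih, veryWellPoised]
    field_simp
    ring

/-! ### Growth of rising factorials and of Γ -/

/-- Rising factorials of two points with the same height grow according to their real parts. -/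
lemma tendsto_norm_rising_div {z w : ℂ} (hre : z.re < w.re) (hsum : 1 ≤ z.re + w.re)
    (him : z.im ^ 2 = w.im ^ 2) :
    Tendsto (fun k => ‖rising z k‖ / ‖rising w k‖) atTop (𝓝 0) := by
  have hw0 : 0 < w.re := by linarith
  have hw : ∀ k : ℕ, w + k ≠ 0 := fun k h => by
    have := congrArg Complex.re h
    simp at this
    have : (0 : ℝ) ≤ k := k.cast_nonneg
    linarith
  -- The squared norms of w + j and z + j differ by at least (w.re - z.re)(j + 1), while ‖w + j‖ ≤
  -- (‖w‖ + 1)(j + 1); c makes each factor ratio at most exp(-c/(j+1)), and the harmonic series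
  -- diverges.
  set c : ℝ := (w.re - z.re) / (2 * (‖w‖ + 1) ^ 2) with hc
  have hc0 : 0 < c := div_pos (by linarith) (by positivity)
  have step (j : ℕ) : ‖z + j‖ ≤ Real.exp (-(c * (1 / (j + 1)))) * ‖w + j‖ := by
    refine le_of_sq_le_sq ?_ (by positivity)
    have hj : (0 : ℝ) ≤ j := j.cast_nonneg
    have hn : ‖w + j‖ ≤ (‖w‖ + 1) * (j + 1) := by
      calc ‖w + j‖ ≤ ‖w‖ + j := by simpa using norm_add_le w (j : ℂ)
        _ ≤ _ := by nlinarith [norm_nonneg w]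
    have hn2 : ‖w + j‖ ^ 2 ≤ ((‖w‖ + 1) * (j + 1)) ^ 2 := by gcongr
    have hdiff : ‖w + j‖ ^ 2 - ‖z + j‖ ^ 2 = (w.re - z.re) * (2 * j + (z.re + w.re)) := by
      simp only [← Complex.normSq_eq_norm_sq, Complex.normSq_apply, Complex.add_re, Complex.add_im,
        Complex.natCast_re, Complex.natCast_im]
      linear_combination -him
    have hdiff' : (w.re - z.re) * (j + 1) ≤ ‖w + j‖ ^ 2 - ‖z + j‖ ^ 2 := by
      rw [hdiff]
      exact mul_le_mul_of_nonneg_left (by linarith) (by linarith)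
    have hcw : 2 * c * (1 / (j + 1)) * ‖w + j‖ ^ 2 ≤ (w.re - z.re) * (j + 1) := by
      calc 2 * c * (1 / (j + 1)) * ‖w + j‖ ^ 2
          ≤ 2 * c * (1 / (j + 1)) * ((‖w‖ + 1) * (j + 1)) ^ 2 := by gcongr
        _ = (w.re - z.re) * (j + 1) := by
          rw [hc]
          have : ‖w‖ + 1 ≠ 0 := by positivity
          field_simp
    calc ‖z + j‖ ^ 2 ≤ (-(2 * c * (1 / (j + 1))) + 1) * ‖w + j‖ ^ 2 := by linarith
      _ ≤ Real.exp (-(2 * c * (1 / (j + 1)))) * ‖w + j‖ ^ 2 := by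
        gcongr; exact Real.add_one_le_exp _
      _ = (Real.exp (-(c * (1 / (j + 1)))) * ‖w + j‖) ^ 2 := by
        rw [mul_pow, ← Real.exp_nat_mul]; congr 2; push_cast; ring
  have bound (k : ℕ) : ‖rising z k‖ / ‖rising w k‖ ≤
      Real.exp (-(c * ∑ j ∈ Finset.range k, 1 / ((j : ℝ) + 1))) := by
    rw [div_le_iff₀ (norm_pos_iff.2 (rising_ne_zero hw k))]
    induction k with
    | zero => simp
    | succ k ih =>
      rw [rising_succ, rising_succ, norm_mul, norm_mul, Finset.sum_range_succ, mul_add, neg_add,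
        Real.exp_add]
      calc _ ≤ _ := mul_le_mul ih (step k) (norm_nonneg _) (by positivity)
        _ = _ := by ring
  refine squeeze_zero (fun k => by positivity) bound ?_
  exact Real.tendsto_exp_neg_atTop_nhds_zero.comp
    (Real.tendsto_sum_range_one_div_nat_succ_atTop.const_mul_atTop hc0)

lemma natCast_mul_norm_rising_le (m k : ℕ) :
    (k + m + 1) * (‖rising (m + 1 / 2) k‖ * ‖rising (1 / 2) k‖) ≤
      (m + 1) * (‖rising 1 k‖ * ‖rising (m + 1) k‖) := by
  induction k with
  | zero => simp
  | succ k ih =>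
    have hre (x : ℝ) (hx : 0 ≤ x) (z : ℂ) (h : z = x) : ‖z‖ = x := by
      rw [h, Complex.norm_real, Real.norm_of_nonneg hx]
    have e1 : ‖(m + 1 / 2 + k : ℂ)‖ = m + 1 / 2 + k := hre _ (by positivity) _ (by push_cast; ring)
    have e2 : ‖(1 / 2 + k : ℂ)‖ = 1 / 2 + k := hre _ (by positivity) _ (by push_cast; ring)
    have e3 : ‖(1 + k : ℂ)‖ = 1 + k := hre _ (by positivity) _ (by push_cast; ring)
    have e4 : ‖(m + 1 + k : ℂ)‖ = m + 1 + k := hre _ (by positivity) _ (by push_cast; ring)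
    simp only [rising_succ, norm_mul, e1, e2, e3, e4]
    set P := ‖rising (m + 1 / 2) k‖ * ‖rising (1 / 2) k‖
    set Q := ‖rising 1 k‖ * ‖rising (m + 1) k‖
    have hP : 0 ≤ P := by positivity
    have hm : (0 : ℝ) ≤ m := m.cast_nonneg
    have hk : (0 : ℝ) ≤ k := k.cast_nonneg
    have hpoly : ((k + 1 : ℝ) + m + 1) * ((m + 1 / 2 + k) * (1 / 2 + k)) ≤
        (k + m + 1) * ((1 + k) * (m + 1 + k)) := by
      nlinarith [mul_nonneg hm hk, mul_nonneg hm hm, mul_nonneg (mul_nonneg hm hm) hk]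
    push_cast
    calc _ = P * (((k + 1 : ℝ) + m + 1) * ((m + 1 / 2 + k) * (1 / 2 + k))) := by ring
      _ ≤ P * ((k + m + 1) * ((1 + k) * (m + 1 + k))) := by gcongr
      _ = ((k + m + 1) * P) * ((1 + k) * (m + 1 + k)) := by ring
      _ ≤ ((m + 1) * Q) * ((1 + k) * (m + 1 + k)) := by gcongr
      _ = _ := by ring

/-- Euler's limit for Γ(s), divided by Γ(s). -/
lemma tendsto_natCast_pow_mul_factorial_div_Gamma {s : ℂ} (hs : ∀ m : ℕ, s ≠ -m) :
    Tendsto (fun m : ℕ => (m : ℂ) ^ s * m.factorial / Complex.Gamma (s + (m + 1))) atTop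
      (𝓝 1) := by
  have h := (Complex.GammaSeq_tendsto_Gamma s).div_const (Complex.Gamma s)
  have h0 := Complex.Gamma_ne_zero hs
  rw [div_self h0] at h
  refine h.congr fun m => ?_
  have hprod (k : ℕ) : ∏ j ∈ Finset.range k, (s + j) = rising s k := by
    induction k with
    | zero => simp
    | succ k ih => rw [Finset.prod_range_succ, ih, rising_succ]
  have hG : Complex.Gamma (s + (m + 1)) = Complex.Gamma s * rising s (m + 1) := by
    have : Complex.Gamma (s + (m + 1 : ℕ)) / Complex.Gamma s = rising s (m + 1) :=
      Complex.Gamma_add_nat_div_Gamma_eq s hs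
    rw [← this]; push_cast; field_simp
  rw [Complex.GammaSeq, hprod, hG, div_div, mul_comm (rising _ _)]

section HalfInteger

variable {n : ℂ}

lemma add_natCast_ne_zero_of_re_pos {z : ℂ} (hz : 0 < z.re) (k : ℕ) : z + k ≠ 0 := fun h => by
  have := congrArg Complex.re h
  simp at this
  have : (0 : ℝ) ≤ k := k.cast_nonneg
  linarith

/-! ### The Gamma quotient -/

/-- The closed form of the very-well-poised sum with parameters `m + 1 / 2`, `1 / 2`, `-n`. -/
noncomputable def gammaQuotient (n : ℂ) (m : ℕ) : ℂ :=
  Complex.Gamma (1 + m) * Complex.Gamma (3 / 2 + n + m) /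
    (Complex.Gamma (3 / 2 + m) * Complex.Gamma (1 + n + m))

lemma gammaQuotient_ne_zero (hn : -3 / 4 < n.re) (m : ℕ) : gammaQuotient n m ≠ 0 := by
  have hm : (0 : ℝ) ≤ m := m.cast_nonneg
  unfold gammaQuotient
  refine div_ne_zero (mul_ne_zero ?_ ?_) (mul_ne_zero ?_ ?_) <;>
    refine Complex.Gamma_ne_zero_of_re_pos ?_ <;> norm_num <;> linarith

lemma gammaQuotient_succ (hn : -3 / 4 < n.re) (m : ℕ) :
    gammaQuotient n (m + 1) * ((3 / 2 + m) * (1 + n + m)) =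
      gammaQuotient n m * ((1 + m) * (3 / 2 + n + m)) := by
  have h1 : (1 : ℂ) + m ≠ 0 := add_natCast_ne_zero_of_re_pos (by norm_num) m
  have h2 : (3 / 2 : ℂ) + n + m ≠ 0 := add_natCast_ne_zero_of_re_pos (by norm_num; linarith) m
  have h3 : (3 / 2 : ℂ) + m ≠ 0 := add_natCast_ne_zero_of_re_pos (by norm_num) m
  have h4 : (1 : ℂ) + n + m ≠ 0 := add_natCast_ne_zero_of_re_pos (by norm_num; linarith) m
  have hm : (0 : ℝ) ≤ m := m.cast_nonneg
  have g3 : Complex.Gamma (3 / 2 + m) ≠ 0 :=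
    Complex.Gamma_ne_zero_of_re_pos (by norm_num; linarith)
  have g4 : Complex.Gamma (1 + n + m) ≠ 0 :=
    Complex.Gamma_ne_zero_of_re_pos (by norm_num; linarith)
  simp only [gammaQuotient, Nat.cast_succ, ← add_assoc, Complex.Gamma_add_one _ h1,
    Complex.Gamma_add_one _ h2, Complex.Gamma_add_one _ h3, Complex.Gamma_add_one _ h4]
  generalize Complex.Gamma (3 / 2 + m) = u at *
  generalize Complex.Gamma (1 + n + m) = v at *
  generalize Complex.Gamma (3 / 2 + n + m) = w at *
  generalize (3 / 2 : ℂ) + m = x at *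
  generalize (1 : ℂ) + n + m = y at *
  field_simp

lemma tendsto_gammaQuotient (hn : -3 / 4 < n.re) :
    Tendsto (gammaQuotient n) atTop (𝓝 1) := by
  have key {s : ℂ} (hs : 0 < s.re) := tendsto_natCast_pow_mul_factorial_div_Gamma (s := s)
    fun m h => add_natCast_ne_zero_of_re_pos hs m (by rw [h]; ring)
  have l1 := key (s := 1) (by norm_num)
  have l2 := key (s := 3 / 2 + n) (by norm_num; linarith)
  have l3 := key (s := 3 / 2) (by norm_num)
  have l4 := key (s := 1 + n) (by norm_num; linarith)
  have l := (l3.mul l4).div (l1.mul l2) (by norm_num)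
  rw [← tendsto_add_atTop_iff_nat 1]
  rw [one_mul, div_one] at l
  refine l.congr' ?_
  filter_upwards [eventually_gt_atTop 0] with m hm
  have hm0 : (m : ℂ) ≠ 0 := Nat.cast_ne_zero.2 hm.ne'
  have hf : (m.factorial : ℂ) ≠ 0 := Nat.cast_ne_zero.2 m.factorial_ne_zero
  -- Both pairs of parameters sum to 5/2 + n, so the powers of m cancel.
  have e : (m : ℂ) ^ (3 / 2 : ℂ) * (m : ℂ) ^ (1 + n) = (m : ℂ) ^ (1 : ℂ) * (m : ℂ) ^ (3 / 2 + n) := by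
    rw [← Complex.cpow_add _ _ hm0, ← Complex.cpow_add _ _ hm0]; congr 1; ring
  have p1 : (m : ℂ) ^ (3 / 2 : ℂ) ≠ 0 := by simp [Complex.cpow_eq_zero_iff, hm0]
  have p2 : (m : ℂ) ^ (1 + n) ≠ 0 := by simp [Complex.cpow_eq_zero_iff, hm0]
  simp only [Pi.div_apply, gammaQuotient, Nat.cast_succ]
  rw [div_mul_div_comm, div_mul_div_comm, mul_mul_mul_comm, mul_mul_mul_comm (_ ^ (1 : ℂ)), ← e,
    div_div_div_cancel_left' _ _ (mul_ne_zero (mul_ne_zero p1 p2) (mul_ne_zero hf hf))]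

/-! ### Estimates at a = m + 1/2, b = 1/2, c = -n -/

lemma half_params (n : ℂ) (m : ℕ) :
    1 + ((m : ℂ) + 1 / 2) - 1 / 2 = m + 1 ∧ 1 + ((m : ℂ) + 1 / 2) - -n = m + (3 / 2 + n) :=
  ⟨by ring, by ring⟩

lemma half_conditions (hn : -3 / 4 < n.re) (m : ℕ) :
    (m : ℂ) + 1 / 2 ≠ 0 ∧ (m : ℂ) + 1 / 2 + 1 ≠ 0 ∧
    (∀ k : ℕ, (1 + ((m : ℂ) + 1 / 2) - 1 / 2) + k ≠ 0) ∧
    ∀ k : ℕ, (1 + ((m : ℂ) + 1 / 2) - -n) + k ≠ 0 := by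
  have hm : (0 : ℝ) ≤ m := m.cast_nonneg
  refine ⟨?_, ?_, add_natCast_ne_zero_of_re_pos ?_, add_natCast_ne_zero_of_re_pos ?_⟩
  · simpa using add_natCast_ne_zero_of_re_pos (z := m + 1 / 2) (by norm_num; linarith) 0
  · simpa using add_natCast_ne_zero_of_re_pos (z := m + 1 / 2) (by norm_num; linarith) 1
  · norm_num; linarith
  · norm_num; linarith

lemma norm_wellPoised_half (n : ℂ) (m k : ℕ) :
    ‖wellPoised (m + 1 / 2) (1 / 2) (-n) k‖ =
      (‖rising (m + 1 / 2) k‖ * ‖rising (1 / 2) k‖) / (‖rising 1 k‖ * ‖rising (m + 1) k‖) *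
      (‖rising (-n) k‖ / ‖rising (m + (3 / 2 + n)) k‖) / (m + 1 / 2) := by
  have h : ‖(m + 1 / 2 : ℂ)‖ = m + 1 / 2 := by
    rw [show (m + 1 / 2 : ℂ) = ((m + 1 / 2 : ℝ) : ℂ) by push_cast; rfl, Complex.norm_real,
      Real.norm_of_nonneg (by positivity)]
  rw [wellPoised, (half_params n m).1, (half_params n m).2]
  simp only [norm_div, norm_mul, norm_pow, norm_neg, norm_one, one_pow, one_mul] at h ⊢
  rw [h, div_mul_div_comm, div_div]
  congr 1
  ring

lemma rising_half_quotient_le (m k : ℕ) :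
    (‖rising (m + 1 / 2) k‖ * ‖rising (1 / 2) k‖) / (‖rising 1 k‖ * ‖rising (m + 1) k‖) ≤
      (m + 1) / (k + m + 1) := by
  have h1 := rising_ne_zero (a := 1) (add_natCast_ne_zero_of_re_pos (by norm_num)) k
  have h2 := rising_ne_zero (a := m + 1) (add_natCast_ne_zero_of_re_pos
    (by norm_num; positivity)) k
  rw [div_le_div_iff₀ (by positivity) (by positivity), mul_comm]
  exact natCast_mul_norm_rising_le m k

lemma tendsto_natCast_mul_wellPoised (hn : -3 / 4 < n.re) (m : ℕ) :
    Tendsto (fun k : ℕ => k * wellPoised (m + 1 / 2) (1 / 2) (-n) k) atTop (𝓝 0) := by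
  have hm : (0 : ℝ) ≤ m := m.cast_nonneg
  -- At m = 0 the condition Re(-n) < Re(3/2 + n) is exactly Re n > -3/4.
  have h := (tendsto_norm_rising_div (z := -n) (w := m + (3 / 2 + n)) (by norm_num; linarith)
    (by norm_num; linarith) (by simp)).const_mul ((m + 1) / ((m : ℝ) + 1 / 2))
  rw [mul_zero] at h
  refine squeeze_zero_norm (fun k => ?_) h
  rw [norm_mul, norm_wellPoised_half, Complex.norm_natCast]
  calc _ ≤ (k : ℝ) * ((m + 1) / (k + m + 1) *
        (‖rising (-n) k‖ / ‖rising (m + (3 / 2 + n)) k‖) / (m + 1 / 2)) := by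
        gcongr (k : ℝ) * (?_ * _ / _)
        exact rising_half_quotient_le m k
    _ = k / (k + m + 1) * ((m + 1) / (m + 1 / 2) *
        (‖rising (-n) k‖ / ‖rising (m + (3 / 2 + n)) k‖)) := by ring
    _ ≤ _ := mul_le_of_le_one_left (by positivity)
        (div_le_one_of_le₀ (by linarith) (by positivity))

lemma norm_veryWellPoised_half_le (n : ℂ) (m k : ℕ) :
    ‖veryWellPoised (m + 1 / 2) (1 / 2) (-n) k‖ ≤
      (4 * k + 1) * (‖rising (-n) k‖ / ‖rising (m + (3 / 2 + n)) k‖) := by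
  have hm : (0 : ℝ) ≤ m := m.cast_nonneg
  have hk : (0 : ℝ) ≤ k := k.cast_nonneg
  have h : ‖(m + 1 / 2 + 2 * k : ℂ)‖ = m + 1 / 2 + 2 * k := by
    rw [show (m + 1 / 2 + 2 * k : ℂ) = ((m + 1 / 2 + 2 * k : ℝ) : ℂ) by push_cast; rfl,
      Complex.norm_real, Real.norm_of_nonneg (by positivity)]
  rw [veryWellPoised, norm_mul, norm_wellPoised_half, h]
  calc _ ≤ (m + 1 / 2 + 2 * k : ℝ) * (1 *
        (‖rising (-n) k‖ / ‖rising (m + (3 / 2 + n)) k‖) / (m + 1 / 2)) := by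
        gcongr
        exact (rising_half_quotient_le m k).trans
          (div_le_one_of_le₀ (by linarith) (by positivity))
    _ = (m + 1 / 2 + 2 * k) / (m + 1 / 2) *
        (‖rising (-n) k‖ / ‖rising (m + (3 / 2 + n)) k‖) := by ring
    _ ≤ _ := by
      gcongr
      rw [div_le_iff₀ (by positivity)]
      nlinarith [mul_nonneg hm hk]

/-- For such m each factor ratio is at most (k + A)/(k + A + 3), and the product telescopes to
O(k⁻³), uniformly in m. This beats the linear factor 4k + 1. -/
lemma norm_rising_div_le {A m : ℕ} (hA : 1 ≤ A) (hnA : ‖n‖ ≤ A) (hm : 2 * A + 3 ≤ m) (k : ℕ) :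
    ‖rising (-n) k‖ / ‖rising (m + (3 / 2 + n)) k‖ ≤
      A * (A + 1) * (A + 2) / ((k + A) * (k + A + 1) * (k + A + 2)) := by
  have hA' : (1 : ℝ) ≤ A := by exact_mod_cast hA
  have hm' : (2 * A + 3 : ℝ) ≤ m := by exact_mod_cast hm
  have hw : (A + 3 : ℝ) ≤ (m + (3 / 2 + n) : ℂ).re := by
    have := (abs_le.1 ((Complex.abs_re_le_norm n).trans hnA)).1
    norm_num
    linarith
  have hne := add_natCast_ne_zero_of_re_pos (lt_of_lt_of_le (by positivity) hw)
  induction k with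
  | zero =>
    simp only [rising_zero, norm_one, Nat.cast_zero, zero_add]
    rw [div_self (by positivity), div_self (by positivity)]
  | succ k ih =>
    have h1 : ‖-n + k‖ ≤ k + A := by
      calc _ ≤ ‖-n‖ + ‖(k : ℂ)‖ := norm_add_le _ _
        _ ≤ _ := by rw [norm_neg, Complex.norm_natCast]; linarith
    have h2 : (k + A + 3 : ℝ) ≤ ‖m + (3 / 2 + n) + (k : ℂ)‖ := by
      refine le_trans ?_ (Complex.re_le_norm _)
      rw [Complex.add_re _ (k : ℂ), Complex.natCast_re]
      linarith
    rw [rising_succ, rising_succ, norm_mul, norm_mul, mul_div_mul_comm]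
    calc _ ≤ (A * (A + 1) * (A + 2) / ((k + A) * (k + A + 1) * (k + A + 2)) : ℝ) *
          ((k + A) / (k + A + 3)) := by gcongr
      _ = _ := by push_cast; field_simp; ring

lemma norm_veryWellPoised_half_le_sq {A m : ℕ} (hA : 1 ≤ A) (hnA : ‖n‖ ≤ A)
    (hm : 2 * A + 3 ≤ m) (k : ℕ) :
    ‖veryWellPoised (m + 1 / 2) (1 / 2) (-n) k‖ ≤
      4 * (A * (A + 1) * (A + 2)) * (1 / ((k + 1 : ℕ) : ℝ) ^ 2) := by
  have hA' : (1 : ℝ) ≤ A := by exact_mod_cast hA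
  refine (norm_veryWellPoised_half_le n m k).trans ?_
  calc _ ≤ (4 * k + 4 : ℝ) * (A * (A + 1) * (A + 2) / ((k + 1) * (k + 1) * (k + 1))) := by
        refine mul_le_mul (by linarith) ((norm_rising_div_le hA hnA hm k).trans ?_)
          (by positivity) (by positivity)
        gcongr <;> linarith
    _ = _ := by push_cast; field_simp

lemma tendsto_veryWellPoised_half (n : ℂ) (k : ℕ) :
    Tendsto (fun m : ℕ => veryWellPoised (m + 1 / 2) (1 / 2) (-n) k) atTop
      (𝓝 (if k = 0 then 1 else 0)) := by
  rcases Nat.eq_zero_or_pos k with rfl | hk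
  · refine tendsto_const_nhds.congr fun m => ?_
    have : (m + 1 / 2 : ℂ) ≠ 0 := by
      simpa using add_natCast_ne_zero_of_re_pos (z := m + 1 / 2) (by norm_num; positivity) 0
    rw [one_div] at this
    simp [veryWellPoised, wellPoised, mul_inv_cancel₀ this]
  · rw [if_neg hk.ne']
    refine squeeze_zero_norm (fun m => norm_veryWellPoised_half_le n m k) ?_
    rw [← mul_zero (4 * (k : ℝ) + 1)]
    refine Tendsto.const_mul _ (Tendsto.const_div_atTop ?_ _)
    -- For fixed k > 0 the denominator is a nonconstant polynomial evaluated at a point going to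
    -- infinity with m.
    refine (ascPochhammer ℂ k).tendsto_norm_atTop ?_ ?_
    · rw [← natDegree_pos_iff_degree_pos, ascPochhammer_natDegree]
      exact hk
    · refine tendsto_atTop_mono (fun m => ?_)
        (tendsto_atTop_add_const_right _ (-‖3 / 2 + n‖) tendsto_natCast_atTop_atTop)
      simpa [← sub_eq_add_neg] using norm_sub_le_norm_add (m : ℂ) (3 / 2 + n)

/-! ### Passage to the limit in m -/

lemma tendsto_sum_div_gammaQuotient_sub (hn : -3 / 4 < n.re) (m : ℕ) :
    Tendsto (fun N : ℕ =>
      (∑ k ∈ Finset.range N, veryWellPoised (m + 1 / 2) (1 / 2) (-n) k) / gammaQuotient n m -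
      (∑ k ∈ Finset.range N, veryWellPoised ((m + 1 : ℕ) + 1 / 2) (1 / 2) (-n) k) /
        gammaQuotient n (m + 1)) atTop (𝓝 0) := by
  have h := (tendsto_natCast_mul_wellPoised hn m).neg.div_const (gammaQuotient n m)
  rw [neg_zero, zero_div] at h
  refine h.congr fun N => ?_
  obtain ⟨ha, ha1, hb, hc⟩ := half_conditions hn m
  have hR := gammaQuotient_ne_zero hn m
  have hR1 := gammaQuotient_ne_zero hn (m + 1)
  have hs := gammaQuotient_succ hn m
  have h1 : (1 : ℂ) + m ≠ 0 := add_natCast_ne_zero_of_re_pos (by norm_num) m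
  have h2 : (3 / 2 : ℂ) + n + m ≠ 0 := add_natCast_ne_zero_of_re_pos (by norm_num; linarith) m
  rw [← sum_veryWellPoised_sub ha ha1 hb hc N, (half_params n m).1, (half_params n m).2, sub_div,
    show (m : ℂ) + 1 / 2 + 1 = (m + 1 : ℕ) + 1 / 2 by push_cast; ring]
  congr 1
  have e : (1 + ((m : ℂ) + 1 / 2)) * (m + 1 - -n) / ((m + 1) * (m + (3 / 2 + n))) =
      gammaQuotient n m / gammaQuotient n (m + 1) := by
    rw [div_eq_div_iff (by
      rw [show ((m : ℂ) + 1) * (m + (3 / 2 + n)) = (1 + m) * (3 / 2 + n + m) by ring]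
      exact mul_ne_zero h1 h2) hR1]
    linear_combination hs
  rw [e]
  field_simp

/-- The very-well-poised sum with parameters `m + 1 / 2`, `1 / 2`, `-n`, at `m = 0`. -/
lemma tendsto_sum_veryWellPoised_half (hn : -3 / 4 < n.re) :
    Tendsto (fun N : ℕ => ∑ k ∈ Finset.range N, veryWellPoised (1 / 2) (1 / 2) (-n) k) atTop
      (𝓝 (gammaQuotient n 0)) := by
  obtain ⟨A, hA⟩ := exists_nat_ge (max ‖n‖ 1)
  have hnA : ‖n‖ ≤ A := (le_max_left _ _).trans hA
  have hA1 : 1 ≤ A := by exact_mod_cast (le_max_right _ _).trans hA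
  set S : ℕ → ℕ → ℂ := fun m N =>
    ∑ k ∈ Finset.range N, veryWellPoised (m + 1 / 2) (1 / 2) (-n) k with hS
  have hdiff (m : ℕ) : Tendsto (fun N => S 0 N / gammaQuotient n 0 - S m N / gammaQuotient n m)
      atTop (𝓝 0) := by
    induction m with
    | zero => simp
    | succ m ih =>
      have h := ih.add (tendsto_sum_div_gammaQuotient_sub hn m)
      rw [add_zero] at h
      exact h.congr fun N => sub_add_sub_cancel _ _ _
  have hsum : Summable fun k : ℕ => 4 * (A * (A + 1) * (A + 2)) * (1 / ((k + 1 : ℕ) : ℝ) ^ 2) :=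
    ((summable_nat_add_iff 1).2 (Real.summable_one_div_nat_pow.2 one_lt_two)).mul_left _
  set T : ℕ → ℂ := fun m => ∑' k, veryWellPoised (m + 1 / 2) (1 / 2) (-n) k with hT
  have hST (m : ℕ) (hm : 2 * A + 3 ≤ m) :
      Tendsto (fun N => S 0 N / gammaQuotient n 0) atTop (𝓝 (T m / gammaQuotient n m)) := by
    have h := (Summable.of_norm_bounded hsum
      (norm_veryWellPoised_half_le_sq hA1 hnA hm)).hasSum.tendsto_sum_nat
    have h' := (hdiff m).add (h.div_const (gammaQuotient n m))
    rw [zero_add] at h'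
    exact h'.congr fun N => sub_add_cancel _ _
  have hT1 : Tendsto T atTop (𝓝 1) := by
    have h := tendsto_tsum_of_dominated_convergence hsum (tendsto_veryWellPoised_half n)
      (eventually_atTop.2 ⟨2 * A + 3, fun m hm => norm_veryWellPoised_half_le_sq hA1 hnA hm⟩)
    rwa [tsum_ite_eq] at h
  -- The quotient is constant for m ≥ 2A + 3, being the limit of one and the same sequence, and it
  -- tends to 1.
  have hlim : T (2 * A + 3) / gammaQuotient n (2 * A + 3) = 1 := by
    have h := hT1.div (tendsto_gammaQuotient hn) one_ne_zero
    rw [div_one] at h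
    refine tendsto_nhds_unique (tendsto_const_nhds.congr' ?_) h
    filter_upwards [eventually_ge_atTop (2 * A + 3)] with m hm
    exact tendsto_nhds_unique (hST _ le_rfl) (hST m hm)
  have h := (hST _ le_rfl).mul_const (gammaQuotient n 0)
  rw [hlim, one_mul] at h
  refine h.congr fun N => ?_
  rw [div_mul_cancel₀ _ (gammaQuotient_ne_zero hn 0)]
  simp [hS]

end HalfInteger

theorem mainTheorem2 :
    Filter.Tendsto
      (fun N : ℕ => ∑ k ∈ Finset.range N,
        (-1 : ℝ) ^ k * (4 * (k : ℝ) + 1) *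
          ((ascPochhammer ℝ k).eval (1 / 2 : ℝ)) ^ 3 / (k.factorial : ℝ) ^ 3)
      Filter.atTop (nhds (2 / Real.pi))
    ∧
    ∀ n : ℂ, -3 / 4 < n.re →
      Filter.Tendsto
        (fun N : ℕ => ∑ k ∈ Finset.range N,
          (-1 : ℂ) ^ k * (4 * (k : ℂ) + 1) *
            (((ascPochhammer ℂ k).eval (1 / 2 : ℂ)) ^ 2 * (ascPochhammer ℂ k).eval (-n)) /
              ((k.factorial : ℂ) ^ 2 * (ascPochhammer ℂ k).eval (3 / 2 + n)))
        Filter.atTop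
        (nhds (Complex.Gamma (3 / 2 + n) / (Complex.Gamma (3 / 2) * Complex.Gamma (n + 1)))) := by
  have main : ∀ n : ℂ, -3 / 4 < n.re →
      Filter.Tendsto
        (fun N : ℕ => ∑ k ∈ Finset.range N,
          (-1 : ℂ) ^ k * (4 * (k : ℂ) + 1) *
            (((ascPochhammer ℂ k).eval (1 / 2 : ℂ)) ^ 2 * (ascPochhammer ℂ k).eval (-n)) /
              ((k.factorial : ℂ) ^ 2 * (ascPochhammer ℂ k).eval (3 / 2 + n)))
        Filter.atTop
        (nhds (Complex.Gamma (3 / 2 + n) / (Complex.Gamma (3 / 2) * Complex.Gamma (n + 1)))) := by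
    intro n hn
    have h := tendsto_sum_veryWellPoised_half hn
    rw [gammaQuotient, Nat.cast_zero, add_zero, add_zero, add_zero, add_zero, Complex.Gamma_one,
      one_mul, add_comm 1 n] at h
    refine h.congr fun N => Finset.sum_congr rfl fun k _ => ?_
    -- At a = 1/2 the factor (a + 2k)/a is 4k + 1, and 1 + a - b = 1 gives the second k!.
    rw [veryWellPoised, wellPoised, show (1 + 1 / 2 - 1 / 2 : ℂ) = 1 by ring,
      show 1 + 1 / 2 - -n = 3 / 2 + n by ring, rising_one]
    simp only [rising]
    rw [← mul_div_assoc, div_mul_eq_div_div, div_div_eq_mul_div, div_one]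
    ring
  refine ⟨?_, main⟩
  have h := main (-1 / 2) (by norm_num)
  have e : Complex.Gamma (3 / 2 + -1 / 2) /
      (Complex.Gamma (3 / 2) * Complex.Gamma (-1 / 2 + 1)) = ((2 / Real.pi : ℝ) : ℂ) := by
    have hpi : (Real.pi : ℂ) ^ (1 / 2 : ℂ) * (Real.pi : ℂ) ^ (1 / 2 : ℂ) = Real.pi := by
      rw [← Complex.cpow_add _ _ (by exact_mod_cast Real.pi_ne_zero)]; norm_num
    rw [show (3 / 2 + -1 / 2 : ℂ) = 1 by norm_num, show (-1 / 2 + 1 : ℂ) = 1 / 2 by norm_num,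
      show (3 / 2 : ℂ) = 1 / 2 + 1 by norm_num, Complex.Gamma_add_one _ (by norm_num),
      Complex.Gamma_one, Complex.Gamma_one_half_eq, mul_assoc, hpi]
    push_cast
    field_simp
  rw [e] at h
  rw [← Filter.tendsto_ofReal_iff]
  refine h.congr fun N => ?_
  push_cast
  refine Finset.sum_congr rfl fun k _ => ?_
  have e1 : (((ascPochhammer ℝ k).eval (1 / 2 : ℝ) : ℝ) : ℂ) =
      (ascPochhammer ℂ k).eval (1 / 2 : ℂ) := by
    have := ascPochhammer_eval₂ Complex.ofRealHom k (Complex.ofRealHom (1 / 2))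
    rw [eval₂_at_apply] at this
    simpa using this.symm
  have e2 := ascPochhammer_eval_one ℂ k
  rw [e1, show (3 / 2 + -1 / 2 : ℂ) = 1 by norm_num, show (-(-1 / 2) : ℂ) = 1 / 2 by norm_num, e2]
  ring
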